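/- **Theorem (Lasota–Yorke inequality for the normalized transfer operator of the uncoupled lattice map).** Let $I$ be the unit interval with a bounded metric $d_I$ (more generally, any bounded metric space), $\theta\in(0,1)$, $\beta>0$, $\Omega=I^{\mathbb Z}$ with the product topology, and $d(x,y)=\sup_{i\in\mathbb Z}\theta^{|i|}d_I(x_i,y_i)$. Let $\tau:I\to I$ have $b$ full branches that are expanding: there are pairwise different maps $\zeta_1,\dots,\zeta_b:I\to I$ (the inverse branches) with $\tau^{-1}\{x\}=\{\zeta_1(x),\dots,\zeta_b(x)\}$ for all $x\in I$, and there is $\eta\in(0,1)$ with $d_I(\zeta_j(x),\zeta_j(y))\le\eta\,d_I(x,y)$ for all $j,x,y$. Let $p$ be a fixed point of $\tau$, and $\bar\tau:\Omega\to\Omega$, $(\bar\tau x)_i=\tau(x_i)$. For $k\in\mathbb N$ let $\Lambda_k=\{-k,\dots,k\}$ and let $\pi_k:\Omega\to\Omega$ keep the coordinates $x_i$ with $i\in\Lambda_k$ and replace all others by $p$. For $\Phi:\Omega\to\mathbb R$ put $|\Phi|_\infty=\sup_\Omega|\Phi|$ and $$|\Phi|_\beta=\sup_{k\in\mathbb N}\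 \sup_{x\ne y}\frac{|\Phi(\pi_kx)-\Phi(\pi_ky)|}{d(x,y)^\beta},\qquad \mathcal C=\{\Phi:\Omega\to\mathbb R\text{ continuous},\ |\Phi|_\infty+|\Phi|_\beta<\infty\}.$$ Let $f\in\mathcal C$. For $\omega\in\{1,\dots,b\}^{\Lambda_k}$ and $x\in\Omega$ let $\zeta^\omega_x\in\Omega$ have the coordinates $\zeta_{\omega_i}(x_i)$ for $i\in\Lambda_k$ and $x_i$ for $i\notin\Lambda_k$, and set $$P_k\Phi(x)=\frac1{b^{2k+1}}\sum_{\omega}e^{f(\pi_k\zeta^\omega_x)}\,\Phi(\pi_k\zeta^\omega_x),\qquad P\Phi(x)=\lim_{k\to\infty}P_k\Phi(x);$$ the limit exists for all $\Phi\in\mathcal C$ and $x\in\Omega$. Let $\nu$ be a Borel probability measure on $\Omega$ with $P^*\nu=\lambda\nu$, that is, $\int P\Phi\,d\nu=\lambda\int\Phi\,d\nu$ for all $\Phi\in\mathcal C$, where $\lambda=\int P\mathbf 1\,d\nu$. Let $h:\Omega\to\mathbb R$ be continuous with $h\ge0$, $\int h\,d\nu=1$, $$h(x)\le \exp\Big(|f|_\beta\tfrac{\eta^\beta}{1-\eta^\beta}d(x,y)^\beta\Big)h(y)\quad\text{for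 all }x,y\in\Omega,$$ and $Ph=\lambda h$. Let $L\Phi=P(h\Phi)/(\lambda h)$ be the normalized transfer operator. Then $L$ maps $\mathcal C$ into $\mathcal C$, and there is a constant $C_5>0$, which depends only on $f$, $h$ and $\tau$ (and on the fixed $d$ and $\beta$), but not on $\nu$, $\Phi$ and $n$, such that $$|L^n\Phi|_\beta\le|\Phi|_\beta\,\eta^{\beta n}+C_5|\Phi|_\infty\qquad\text{for all }\Phi\in\mathcal C,\ n\in\mathbb N .$$ -/

import Mathlib

open Filter Topology MeasureTheory
open scoped ENNReal

namespace LatticeMap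

noncomputable section

/-- The metric `d(x, y) = sup_k θ^|k| d_I(x_k, y_k)` on the lattice space `Ω = I^ℤ`.  For a bounded
metric `d_I` and `0 < θ < 1` it induces the product topology, which is the one used on `ℤ → I`. -/
def latticeDist {I : Type*} [MetricSpace I] (θ : ℝ) (x y : ℤ → I) : ℝ :=
  ⨆ k : ℤ, θ ^ k.natAbs * dist (x k) (y k)

/-- The map `τ` has `b` full branches with inverse branches `ζ 0, …, ζ (b - 1)`, all of which
contract distances by the factor `η`. -/
structure IsFullBranchExpanding {I : Type*} [MetricSpace I] (τ : I → I) {b : ℕ}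
    (ζ : Fin b → I → I) (η : ℝ) : Prop where
  /-- the inverse branches are pairwise different maps -/
  branches_distinct : Function.Injective ζ
  /-- the points of the fibre over `x` are the images of `x` under the inverse branches -/
  fibre : ∀ x : I, τ ⁻¹' {x} = Set.range fun j => ζ j x
  eta_pos : 0 < η
  eta_lt_one : η < 1
  contracts : ∀ (j : Fin b) (x y : I), dist (ζ j x) (ζ j y) ≤ η * dist x y

/-- The finite sublattice `Λ_k = {-k, …, k}`. -/
abbrev box (k : ℕ) : Finset ℤ := Finset.Icc (-(k : ℤ)) (k : ℤ)

/-- The projection `π_k`: keep the coordinates in `Λ_k`, put the fixed point `p` elsewhere. -/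
def proj {I : Type*} (p : I) (k : ℕ) (x : ℤ → I) : ℤ → I :=
  fun i => if i ∈ box k then x i else p

/-- The sup norm `|Φ|_∞` (with value `∞` for unbounded functions). -/
def supNorm {X : Type*} (Φ : X → ℝ) : ℝ≥0∞ := ⨆ x, ENNReal.ofReal |Φ x|

/-- The quotient `sup_{x ≠ y} |Ψ(x) - Ψ(y)| / d(x, y)^β`. -/
def holderQuotient {I : Type*} [MetricSpace I] (θ β : ℝ) (Ψ : (ℤ → I) → ℝ) : ℝ≥0∞ :=
  ⨆ (x : ℤ → I) (y : ℤ → I) (_ : x ≠ y),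
    ENNReal.ofReal (|Ψ x - Ψ y| / latticeDist θ x y ^ β)

/-- The Hölder constant `|Φ|_β = sup_k |Φ_k|_β`, where `Φ_k = Φ ∘ π_k`. -/
def holderConst {I : Type*} [MetricSpace I] (θ β : ℝ) (p : I) (Φ : (ℤ → I) → ℝ) : ℝ≥0∞ :=
  ⨆ k : ℕ, holderQuotient θ β (Φ ∘ proj p k)

/-- The space `𝒞` of continuous functions with `|Φ|_∞ + |Φ|_β < ∞`. -/
def holderSpace {I : Type*} [MetricSpace I] (θ β : ℝ) (p : I) : Set ((ℤ → I) → ℝ) :=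
  {Φ | Continuous Φ ∧ supNorm Φ + holderConst θ β p Φ < ∞}

/-- The inverse branch of the product map on `Λ_k` that uses the inverse branch `ζ (ω i)` at the
site `i ∈ Λ_k`; the coordinates outside `Λ_k` are left as they are. -/
def latticeBranch {I : Type*} {b : ℕ} (ζ : Fin b → I → I) (k : ℕ) (ω : box k → Fin b)
    (x : ℤ → I) : ℤ → I :=
  fun i => if hi : i ∈ box k then ζ (ω ⟨i, hi⟩) (x i) else x i

/-- The transfer operator `P_k` of the finite sublattice `Λ_k` with potential `f`. -/
def finiteTransfer {I : Type*} {b : ℕ} (ζ : Fin b → I → I) (p : I) (f : (ℤ → I) → ℝ) (k : ℕ)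
    (Φ : (ℤ → I) → ℝ) : (ℤ → I) → ℝ :=
  fun x => (1 / (b : ℝ) ^ (2 * k + 1)) * ∑ ω : box k → Fin b,
    Real.exp (f (proj p k (latticeBranch ζ k ω x))) * Φ (proj p k (latticeBranch ζ k ω x))

/-- The transfer operator `P` of the infinite lattice, the pointwise limit of the `P_k`. -/
def transfer {I : Type*} {b : ℕ} (ζ : Fin b → I → I) (p : I) (f : (ℤ → I) → ℝ)
    (Φ : (ℤ → I) → ℝ) : (ℤ → I) → ℝ :=
  fun x => limUnder atTop fun k => finiteTransfer ζ p f k Φ x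

/-- The eigenvalue `λ = (P^* ν)(1)`. -/
def eigenvalue {I : Type*} [MetricSpace I] [MeasurableSpace (ℤ → I)] {b : ℕ}
    (ζ : Fin b → I → I) (p : I) (f : (ℤ → I) → ℝ) (ν : Measure (ℤ → I)) : ℝ :=
  ∫ x, transfer ζ p f (fun _ => 1) x ∂ν

/-- `ν` is a probability measure with `P^* ν = λ ν`, where `λ = (P^* ν)(1)`. -/
structure IsEigenmeasure {I : Type*} [MetricSpace I] [MeasurableSpace (ℤ → I)] {b : ℕ}
    (θ β : ℝ) (ζ : Fin b → I → I) (p : I) (f : (ℤ → I) → ℝ) (ν : Measure (ℤ → I)) : Prop where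
  prob : IsProbabilityMeasure ν
  dual : ∀ Φ ∈ holderSpace θ β p,
    ∫ x, transfer ζ p f Φ x ∂ν = eigenvalue ζ p f ν * ∫ x, Φ x ∂ν

/-- The distortion bound `B(z) = exp(|f|_β η^β / (1 - η^β) z^β)`. -/
def distortion {I : Type*} [MetricSpace I] (θ β η : ℝ) (p : I) (f : (ℤ → I) → ℝ) (z : ℝ) : ℝ :=
  Real.exp ((holderConst θ β p f).toReal * (η ^ β / (1 - η ^ β)) * z ^ β)

/-- The set `Δ_f` of nonnegative continuous functions of `ν`-integral one with
`Φ(x) ≤ B(d(x, y)) Φ(y)` for all `x, y`. -/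
def densities {I : Type*} [MetricSpace I] [MeasurableSpace (ℤ → I)] (θ β η : ℝ) (p : I)
    (f : (ℤ → I) → ℝ) (ν : Measure (ℤ → I)) : Set ((ℤ → I) → ℝ) :=
  {Φ | Continuous Φ ∧ (∀ x, 0 ≤ Φ x) ∧ ∫ x, Φ x ∂ν = 1 ∧
    ∀ x y, Φ x ≤ distortion θ β η p f (latticeDist θ x y) * Φ y}

/-- The normalized transfer operator `L Φ = P (h Φ) / (λ h)`. -/
def normalizedTransfer {I : Type*} [MetricSpace I] [MeasurableSpace (ℤ → I)] {b : ℕ}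
    (ζ : Fin b → I → I) (p : I) (f : (ℤ → I) → ℝ) (ν : Measure (ℤ → I)) (h : (ℤ → I) → ℝ)
    (Φ : (ℤ → I) → ℝ) : (ℤ → I) → ℝ :=
  fun x => transfer ζ p f (fun y => h y * Φ y) x / (eigenvalue ζ p f ν * h x)

end

end LatticeMap

/-! With `G = e^f h`, the function `L Φ` at `x` is the limit of averages of `Φ` over the projected
preimages `u_ω` of `x`, with weights `G(u_ω) / (λ h(x))`. As `P h = λ h`, the mean weight tends to
1, so `L` does not increase the sup norm. With `v_ω` the preimages of `y`, each term of `L Φ(x) - L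
Φ(y)` splits into a weight at `x` times `Φ(u_ω) - Φ(v_ω)`, plus a difference of weights times
`Φ(v_ω)`. The inverse branches contract, so the first part contributes at most `|Φ|_β η^β d(x,
y)^β`. The weights are Hölder, so the second contributes at most `c |Φ|_∞ d(x, y)^β`. This is
`lasotaYorke_one_step`; iterating it (`lasotaYorke_iterate`) sums a geometric series of ratio `η^β`.
The constant is independent of `ν` because `λ ≥ e^{-|f|_∞}` (`exp_neg_le_eigenvalue`) and because
the distortion bound keeps `h` Hölder and away from zero (`exists_isHolder_of_mem_densities`). -/

namespace LatticeMap

/-! ### The lattice metric and Hölder functions. -/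

section Metric

variable {I : Type*} [MetricSpace I]

/-- `Φ` is Hölder continuous with exponent `β` and constant `K` for the metric `latticeDist θ`. -/
def IsHolder (θ β : ℝ) (Φ : (ℤ → I) → ℝ) (K : ℝ) : Prop :=
  ∀ x y, |Φ x - Φ y| ≤ K * latticeDist θ x y ^ β

variable {θ β : ℝ}

theorem latticeDist_nonneg (hθ0 : 0 < θ) (x y : ℤ → I) : 0 ≤ latticeDist θ x y :=
  Real.iSup_nonneg fun _ => mul_nonneg (pow_nonneg hθ0.le _) dist_nonneg

theorem latticeDist_le {x y : ℤ → I} {c : ℝ}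
    (h : ∀ i, θ ^ i.natAbs * dist (x i) (y i) ≤ c) : latticeDist θ x y ≤ c :=
  ciSup_le h

theorem latticeDist_self (x : ℤ → I) : latticeDist θ x x = 0 := by
  simp [latticeDist]

theorem mem_box {k : ℕ} {i : ℤ} : i ∈ box k ↔ i.natAbs ≤ k := by
  rw [Finset.mem_Icc]; omega

theorem tendsto_proj (p : I) (x : ℤ → I) : Tendsto (fun k => proj p k x) atTop (𝓝 x) := by
  refine tendsto_pi_nhds.2 fun i => tendsto_const_nhds.congr' ?_
  filter_upwards [eventually_ge_atTop i.natAbs] with k hk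
  rw [proj, if_pos (mem_box.2 hk)]

theorem IsHolder.mul (hθ0 : 0 < θ) {Φ Ψ : (ℤ → I) → ℝ} {K L M N : ℝ}
    (hΦ : IsHolder θ β Φ K) (hΨ : IsHolder θ β Ψ L) (hM : ∀ x, |Φ x| ≤ M) (hN : ∀ x, |Ψ x| ≤ N) :
    IsHolder θ β (fun x => Φ x * Ψ x) (M * L + K * N) := by
  intro x y
  have hd : 0 ≤ latticeDist θ x y ^ β := Real.rpow_nonneg (latticeDist_nonneg hθ0 x y) β
  calc |Φ x * Ψ x - Φ y * Ψ y| = |Φ x * (Ψ x - Ψ y) + (Φ x - Φ y) * Ψ y| := by ring_nf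
    _ ≤ |Φ x| * |Ψ x - Ψ y| + |Φ x - Φ y| * |Ψ y| := by
        rw [← abs_mul, ← abs_mul]; exact abs_add_le _ _
    _ ≤ M * (L * latticeDist θ x y ^ β) + K * latticeDist θ x y ^ β * N := by
        have h1 := (abs_nonneg _).trans (hM x)
        have h2 := (abs_nonneg _).trans (hΦ x y)
        exact add_le_add (mul_le_mul (hM x) (hΨ x y) (abs_nonneg _) h1)
          (mul_le_mul (hΦ x y) (hN y) (abs_nonneg _) h2)
    _ = _ := by ring

/-- By convexity `e^a - e^b ≤ e^a (a - b)`, so only `a` has to be bounded above. -/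
theorem exp_sub_exp_le {a b M : ℝ} (ha : a ≤ M) : Real.exp a - Real.exp b ≤
    Real.exp M * |a - b| := by
  have h1 : Real.exp b = Real.exp a * Real.exp (b - a) := by rw [← Real.exp_add]; ring_nf
  have h2 := Real.add_one_le_exp (b - a)
  have h3 := Real.exp_le_exp.2 ha
  have h4 := le_abs_self (a - b)
  calc Real.exp a - Real.exp b = Real.exp a * (1 - Real.exp (b - a)) := by rw [h1]; ring
    _ ≤ Real.exp a * |a - b| := by gcongr; linarith
    _ ≤ _ := by gcongr

theorem IsHolder.exp {Φ : (ℤ → I) → ℝ} {K M : ℝ} (hΦ : IsHolder θ β Φ K)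
    (hM : ∀ x, |Φ x| ≤ M) : IsHolder θ β (fun x => Real.exp (Φ x)) (Real.exp M * K) := by
  intro x y
  have h1 := exp_sub_exp_le (b := Φ y) ((le_abs_self _).trans (hM x))
  have h2 := exp_sub_exp_le (b := Φ x) ((le_abs_self _).trans (hM y))
  rw [abs_sub_comm (Φ y)] at h2
  calc |Real.exp (Φ x) - Real.exp (Φ y)| ≤ Real.exp M * |Φ x - Φ y| :=
        abs_le.2 ⟨by linarith, h1⟩
    _ ≤ Real.exp M * (K * latticeDist θ x y ^ β) := by gcongr; exact hΦ x y
    _ = _ := by ring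

theorem abs_le_of_mem_holderSpace {p : I} {Φ : (ℤ → I) → ℝ} (h : Φ ∈ holderSpace θ β p)
    (x : ℤ → I) : |Φ x| ≤ (supNorm Φ).toReal :=
  (ENNReal.ofReal_le_iff_le_toReal (ENNReal.add_lt_top.1 h.2).1.ne).1
    (le_iSup (fun x => ENNReal.ofReal |Φ x|) x)

variable [BoundedSpace I]

theorem weighted_dist_le_diam (hθ0 : 0 < θ) (hθ1 : θ < 1) (x y : ℤ → I) (i : ℤ) :
    θ ^ i.natAbs * dist (x i) (y i) ≤ Metric.diam (Set.univ : Set I) := by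
  calc θ ^ i.natAbs * dist (x i) (y i) ≤ 1 * dist (x i) (y i) := by
        gcongr
        exact pow_le_one₀ hθ0.le hθ1.le
    _ = dist (x i) (y i) := one_mul _
    _ ≤ _ := Metric.dist_le_diam_of_mem (Bornology.IsBounded.all _) (Set.mem_univ _)
        (Set.mem_univ _)

theorem le_latticeDist (hθ0 : 0 < θ) (hθ1 : θ < 1) (x y : ℤ → I) (i : ℤ) :
    θ ^ i.natAbs * dist (x i) (y i) ≤ latticeDist θ x y :=
  le_ciSup (f := fun i : ℤ => θ ^ i.natAbs * dist (x i) (y i))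
    ⟨_, Set.forall_mem_range.2 (weighted_dist_le_diam hθ0 hθ1 x y)⟩ i

theorem latticeDist_le_diam (hθ0 : 0 < θ) (hθ1 : θ < 1) (x y : ℤ → I) :
    latticeDist θ x y ≤ Metric.diam (Set.univ : Set I) :=
  latticeDist_le (weighted_dist_le_diam hθ0 hθ1 x y)

theorem latticeDist_pos (hθ0 : 0 < θ) (hθ1 : θ < 1) {x y : ℤ → I} (hxy : x ≠ y) :
    0 < latticeDist θ x y := by
  obtain ⟨i, hi⟩ := Function.ne_iff.1 hxy
  exact (mul_pos (pow_pos hθ0 _) (dist_pos.2 hi)).trans_le (le_latticeDist hθ0 hθ1 x y i)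

theorem latticeDist_proj_le (hθ0 : 0 < θ) (hθ1 : θ < 1) (p : I) (k : ℕ) (x y : ℤ → I) :
    latticeDist θ (proj p k x) (proj p k y) ≤ latticeDist θ x y := by
  refine latticeDist_le fun i => ?_
  by_cases hi : i ∈ box k
  · simpa only [proj, if_pos hi] using le_latticeDist hθ0 hθ1 x y i
  · simpa only [proj, if_neg hi, dist_self, mul_zero] using latticeDist_nonneg hθ0 x y

/-- Configurations that agree on `Λ_k` are close. -/
theorem latticeDist_le_of_eqOn_box (hθ0 : 0 < θ) (hθ1 : θ < 1) {k : ℕ} {x y : ℤ → I}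
    (h : ∀ i ∈ box k, x i = y i) :
    latticeDist θ x y ≤ θ ^ k * Metric.diam (Set.univ : Set I) := by
  refine latticeDist_le fun i => ?_
  by_cases hi : i ∈ box k
  · rw [h i hi, dist_self, mul_zero]
    exact mul_nonneg (pow_nonneg hθ0.le _) Metric.diam_nonneg
  · rw [mem_box] at hi
    gcongr ?_ * ?_
    · exact pow_le_pow_of_le_one hθ0.le hθ1.le (by omega)
    · exact Metric.dist_le_diam_of_mem (Bornology.IsBounded.all _) (Set.mem_univ _)
        (Set.mem_univ _)

/-- Sites outside `Λ_N` contribute at most `θ^N` times the diameter; the finitely many others are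
controlled by the product topology. -/
theorem tendsto_latticeDist (hθ0 : 0 < θ) (hθ1 : θ < 1) (x : ℤ → I) :
    Tendsto (fun y => latticeDist θ y x) (𝓝 x) (𝓝 0) := by
  rw [Metric.tendsto_nhds]
  intro ε hε
  have hlim : Tendsto (fun N : ℕ => θ ^ N * Metric.diam (Set.univ : Set I)) atTop (𝓝 0) := by
    simpa using (tendsto_pow_atTop_nhds_zero_of_lt_one hθ0.le hθ1).mul_const
      (Metric.diam (Set.univ : Set I))
  obtain ⟨N, hN⟩ := (hlim.eventually (gt_mem_nhds (half_pos hε))).exists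
  have hnear : ∀ᶠ y in 𝓝 x, ∀ i ∈ box N, dist (y i) (x i) < ε / 2 :=
    (Filter.eventually_all_finset _).2 fun i _ =>
      Metric.tendsto_nhds.1 ((continuous_apply i).tendsto x) _ (half_pos hε)
  filter_upwards [hnear] with y hy
  rw [Real.dist_0_eq_abs, abs_of_nonneg (latticeDist_nonneg hθ0 y x)]
  refine (latticeDist_le (c := ε / 2) fun i => ?_).trans_lt (half_lt_self hε)
  by_cases hi : i ∈ box N
  · calc θ ^ i.natAbs * dist (y i) (x i) ≤ 1 * dist (y i) (x i) := by
          gcongr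
          exact pow_le_one₀ hθ0.le hθ1.le
      _ ≤ ε / 2 := by rw [one_mul]; exact (hy i hi).le
  · rw [mem_box] at hi
    refine le_trans ?_ hN.le
    gcongr ?_ * ?_
    · exact pow_le_pow_of_le_one hθ0.le hθ1.le (by omega)
    · exact Metric.dist_le_diam_of_mem (Bornology.IsBounded.all _) (Set.mem_univ _)
        (Set.mem_univ _)

theorem IsHolder.continuous (hθ0 : 0 < θ) (hθ1 : θ < 1) (hβ : 0 < β) {Φ : (ℤ → I) → ℝ} {K : ℝ}
    (h : IsHolder θ β Φ K) : Continuous Φ := by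
  refine continuous_iff_continuousAt.2 fun x => ?_
  rw [ContinuousAt, tendsto_iff_dist_tendsto_zero]
  have hlim : Tendsto (fun y => K * latticeDist θ y x ^ β) (𝓝 x) (𝓝 0) := by
    have := ((tendsto_latticeDist hθ0 hθ1 x).rpow_const (Or.inr hβ.le)).const_mul K
    simpa [Real.zero_rpow hβ.ne'] using this
  exact squeeze_zero (fun _ => dist_nonneg) (fun y => h y x) hlim

theorem holderConst_le (hθ0 : 0 < θ) (hθ1 : θ < 1) (hβ : 0 < β) (p : I) {Φ : (ℤ → I) → ℝ} {K : ℝ}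
    (hK : 0 ≤ K) (h : IsHolder θ β Φ K) : holderConst θ β p Φ ≤ ENNReal.ofReal K := by
  refine iSup_le fun k => iSup_le fun x => iSup_le fun y => iSup_le fun _ =>
    ENNReal.ofReal_le_ofReal ?_
  refine div_le_of_le_mul₀ (Real.rpow_nonneg (latticeDist_nonneg hθ0 x y) β) hK ?_
  refine (h _ _).trans ?_
  gcongr
  · exact latticeDist_nonneg hθ0 _ _
  · exact latticeDist_proj_le hθ0 hθ1 p k x y

/-- Since `π_k x → x`, continuity carries the bounds on `Φ ∘ π_k` over to `Φ`. With
`holderConst_le`, `|Φ|_β` becomes an ordinary Hölder constant, and the projections can be forgotten.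
-/
theorem isHolder_of_mem_holderSpace (hθ0 : 0 < θ) (hθ1 : θ < 1) (hβ : 0 < β) {p : I}
    {Φ : (ℤ → I) → ℝ} (h : Φ ∈ holderSpace θ β p) :
    IsHolder θ β Φ (holderConst θ β p Φ).toReal := by
  intro x y
  rcases eq_or_ne x y with rfl | hxy
  · simp [latticeDist_self, Real.zero_rpow hβ.ne']
  have hfin : holderConst θ β p Φ ≠ ∞ := (ENNReal.add_lt_top.1 h.2).2.ne
  have hd : 0 < latticeDist θ x y ^ β := Real.rpow_pos_of_pos (latticeDist_pos hθ0 hθ1 hxy) β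
  have hlim : Tendsto (fun k => |Φ (proj p k x) - Φ (proj p k y)|) atTop (𝓝 |Φ x - Φ y|) :=
    (((h.1.tendsto x).comp (tendsto_proj p x)).sub ((h.1.tendsto y).comp (tendsto_proj p y))).abs
  refine le_of_tendsto' hlim fun k => ?_
  rw [← div_le_iff₀ hd]
  refine (ENNReal.ofReal_le_iff_le_toReal hfin).1 ?_
  refine le_trans ?_ (le_iSup (fun k => holderQuotient θ β (Φ ∘ proj p k)) k)
  exact le_iSup₂_of_le x y (le_iSup (fun _ : x ≠ y => ENNReal.ofReal
    (|(Φ ∘ proj p k) x - (Φ ∘ proj p k) y| / latticeDist θ x y ^ β)) hxy)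

theorem mem_holderSpace (hθ0 : 0 < θ) (hθ1 : θ < 1) (hβ : 0 < β) (p : I) {Φ : (ℤ → I) → ℝ}
    {K M : ℝ} (hK : 0 ≤ K) (h : IsHolder θ β Φ K) (hM : ∀ x, |Φ x| ≤ M) :
    Φ ∈ holderSpace θ β p := by
  refine ⟨h.continuous hθ0 hθ1 hβ, ENNReal.add_lt_top.2 ⟨?_, ?_⟩⟩
  · exact (iSup_le fun x => ENNReal.ofReal_le_ofReal (hM x)).trans_lt ENNReal.ofReal_lt_top
  · exact (holderConst_le hθ0 hθ1 hβ p hK h).trans_lt ENNReal.ofReal_lt_top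

end Metric

/-! ### Averages over inverse branches. -/

section Average

variable {I : Type*} {b : ℕ}

/-- The average of `Ψ` over the preimages of `x` under the inverse branches on `Λ_k`, projected
to `Λ_k`. -/
noncomputable def branchAverage (ζ : Fin b → I → I) (p : I) (k : ℕ) (Ψ : (ℤ → I) → ℝ)
    (x : ℤ → I) : ℝ :=
  (1 / (b : ℝ) ^ (2 * k + 1)) * ∑ ω : box k → Fin b, Ψ (proj p k (latticeBranch ζ k ω x))

theorem card_box (k : ℕ) : Fintype.card (box k) = 2 * k + 1 := by
  rw [Fintype.card_coe, Int.card_Icc]; omega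

theorem average_le_of_forall_le (hb : 0 < b) {k : ℕ} {u : (box k → Fin b) → ℝ} {c : ℝ}
    (h : ∀ ω, u ω ≤ c) : (1 / (b : ℝ) ^ (2 * k + 1)) * ∑ ω, u ω ≤ c := by
  have hb' : (0 : ℝ) < (b : ℝ) ^ (2 * k + 1) := by positivity
  have hs : ∑ ω, u ω ≤ (b : ℝ) ^ (2 * k + 1) * c := by
    refine (Finset.sum_le_card_nsmul _ _ c fun ω _ => h ω).trans_eq ?_
    rw [Finset.card_univ, Fintype.card_fun, card_box, Fintype.card_fin, nsmul_eq_mul]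
    push_cast; rfl
  rw [one_div, inv_mul_le_iff₀ hb']
  exact hs

theorem abs_average_le (k : ℕ) (u : (box k → Fin b) → ℝ) :
    |(1 / (b : ℝ) ^ (2 * k + 1)) * ∑ ω, u ω| ≤ (1 / (b : ℝ) ^ (2 * k + 1)) * ∑ ω, |u ω| := by
  rw [abs_mul, abs_of_nonneg (by positivity : (0 : ℝ) ≤ 1 / (b : ℝ) ^ (2 * k + 1))]
  gcongr
  exact Finset.abs_sum_le_sum_abs _ _

theorem abs_average_le_of_forall_le (hb : 0 < b) {k : ℕ} {u : (box k → Fin b) → ℝ} {c : ℝ}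
    (h : ∀ ω, |u ω| ≤ c) : |(1 / (b : ℝ) ^ (2 * k + 1)) * ∑ ω, u ω| ≤ c :=
  (abs_average_le k u).trans (average_le_of_forall_le hb h)

theorem box_subset_succ (k : ℕ) : box k ⊆ box (k + 1) := fun i hi => by
  rw [mem_box] at *; omega

/-- The restriction of a family of branches from `Λ_{k+1}` to `Λ_k`. -/
def restrictBranches (k : ℕ) (ω : box (k + 1) → Fin b) : box k → Fin b :=
  fun i => ω ⟨i, box_subset_succ k i.2⟩

theorem sum_restrictBranches (k : ℕ) (F : (box k → Fin b) → ℝ) :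
    ∑ ω : box (k + 1) → Fin b, F (restrictBranches k ω) = (b : ℝ) ^ 2 * ∑ ω, F ω := by
  classical
  let e : {i : box (k + 1) // (i : ℤ) ∈ box k} ≃ box k :=
    ⟨fun i => ⟨i.1, i.2⟩, fun i => ⟨⟨i, box_subset_succ k i.2⟩, i.2⟩, fun _ => rfl, fun _ => rfl⟩
  have hc : Fintype.card {i : box (k + 1) // ¬ (i : ℤ) ∈ box k} = 2 := by
    rw [Fintype.card_subtype_compl, Fintype.card_congr e, card_box, card_box]; omega
  let E := (Equiv.piEquivPiSubtypeProd (fun i : box (k + 1) => (i : ℤ) ∈ box k)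
    fun _ => Fin b).trans ((e.arrowCongr (Equiv.refl (Fin b))).prodCongr (Equiv.refl _))
  calc ∑ ω : box (k + 1) → Fin b, F (restrictBranches k ω)
      = ∑ q : (box k → Fin b) × ({i : box (k + 1) // ¬ (i : ℤ) ∈ box k} → Fin b), F q.1 :=
        Fintype.sum_equiv E _ _ fun _ => rfl
    _ = _ := by
        rw [Fintype.sum_prod_type]
        simp only [Finset.sum_const, Finset.card_univ, Fintype.card_fun, hc, Fintype.card_fin,
          nsmul_eq_mul, ← Finset.mul_sum]
        push_cast; rfl

/-- Indexing the average by the branches on `Λ_{k+1}` allows consecutive averages to be compared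
term by term. -/
theorem branchAverage_eq_succ (hb : 0 < b) (ζ : Fin b → I → I) (p : I) (k : ℕ)
    (Ψ : (ℤ → I) → ℝ) (x : ℤ → I) :
    branchAverage ζ p k Ψ x = (1 / (b : ℝ) ^ (2 * (k + 1) + 1)) *
      ∑ ω, Ψ (proj p k (latticeBranch ζ k (restrictBranches k ω) x)) := by
  rw [sum_restrictBranches k fun ω => Ψ (proj p k (latticeBranch ζ k ω x)), branchAverage,
    ← mul_assoc]
  congr 1
  have : (b : ℝ) ≠ 0 := by positivity
  field_simp
  ring

end Average

/-! ### Existence of the transfer operator and the one-step estimate. -/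

section Transfer

variable {I : Type*} [MetricSpace I] {b : ℕ} {θ β η : ℝ} {τ : I → I} {ζ : Fin b → I → I}

theorem IsFullBranchExpanding.card_pos (hτ : IsFullBranchExpanding τ ζ η) {p : I} (hp : τ p = p) :
    0 < b := by
  have : p ∈ Set.range fun j => ζ j p := by rw [← hτ.fibre p]; exact hp
  obtain ⟨j, _⟩ := this
  exact j.pos

variable [BoundedSpace I]

theorem IsFullBranchExpanding.latticeDist_branch_le (hτ : IsFullBranchExpanding τ ζ η)
    (hθ0 : 0 < θ) (hθ1 : θ < 1) (p : I) (k : ℕ) (ω : box k → Fin b) (x y : ℤ → I) :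
    latticeDist θ (proj p k (latticeBranch ζ k ω x)) (proj p k (latticeBranch ζ k ω y)) ≤
      η * latticeDist θ x y := by
  refine latticeDist_le fun i => ?_
  by_cases hi : i ∈ box k
  · simp only [proj, latticeBranch, if_pos hi, dif_pos hi]
    calc θ ^ i.natAbs * dist (ζ (ω ⟨i, hi⟩) (x i)) (ζ (ω ⟨i, hi⟩) (y i))
        ≤ θ ^ i.natAbs * (η * dist (x i) (y i)) := by gcongr; exact hτ.contracts _ _ _
      _ = η * (θ ^ i.natAbs * dist (x i) (y i)) := by ring
      _ ≤ _ := mul_le_mul_of_nonneg_left (le_latticeDist hθ0 hθ1 x y i) hτ.eta_pos.le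
  · simpa only [proj, if_neg hi, dist_self, mul_zero] using
      mul_nonneg hτ.eta_pos.le (latticeDist_nonneg hθ0 x y)

theorem IsHolder.abs_branch_sub_le (hτ : IsFullBranchExpanding τ ζ η)
    (hθ0 : 0 < θ) (hθ1 : θ < 1) (hβ : 0 < β) {Ψ : (ℤ → I) → ℝ} {K : ℝ} (hK : 0 ≤ K)
    (h : IsHolder θ β Ψ K) (p : I) (k : ℕ) (ω : box k → Fin b) (x y : ℤ → I) :
    |Ψ (proj p k (latticeBranch ζ k ω x)) - Ψ (proj p k (latticeBranch ζ k ω y))| ≤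
      K * η ^ β * latticeDist θ x y ^ β := by
  have hd := latticeDist_nonneg hθ0 x y
  rw [mul_assoc, ← Real.mul_rpow hτ.eta_pos.le hd]
  refine (h _ _).trans ?_
  gcongr
  · exact latticeDist_nonneg hθ0 _ _
  · exact hτ.latticeDist_branch_le hθ0 hθ1 p k ω x y

/-- Matched points of consecutive averages agree on `Λ_k`, so the averages differ by at most `K (θ^k
D)^β`: a Cauchy sequence of geometric rate `θ^β`. -/
theorem IsHolder.exists_tendsto_branchAverage (hb : 0 < b) (hθ0 : 0 < θ) (hθ1 : θ < 1)
    (hβ : 0 < β) {Ψ : (ℤ → I) → ℝ} {K : ℝ} (hK : 0 ≤ K) (h : IsHolder θ β Ψ K)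
    (ζ : Fin b → I → I) (p : I) (x : ℤ → I) :
    ∃ a, Tendsto (fun k => branchAverage ζ p k Ψ x) atTop (𝓝 a) := by
  set D := Metric.diam (Set.univ : Set I)
  have hD : 0 ≤ D := Metric.diam_nonneg
  refine cauchySeq_tendsto_of_complete (cauchySeq_of_le_geometric (θ ^ β) (K * D ^ β)
    (Real.rpow_lt_one hθ0.le hθ1 hβ) fun k => ?_)
  rw [branchAverage_eq_succ hb ζ p k, Real.dist_eq, branchAverage, ← mul_sub,
    ← Finset.sum_sub_distrib]
  refine abs_average_le_of_forall_le hb fun ω => ?_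
  have hpow : (θ ^ β) ^ k = (θ ^ k) ^ β := by
    rw [← Real.rpow_natCast, ← Real.rpow_mul hθ0.le, mul_comm, Real.rpow_mul hθ0.le,
      Real.rpow_natCast]
  rw [hpow, mul_assoc, mul_comm (D ^ β), ← Real.mul_rpow (by positivity) hD]
  refine (h _ _).trans ?_
  gcongr
  · exact latticeDist_nonneg hθ0 _ _
  · refine latticeDist_le_of_eqOn_box hθ0 hθ1 fun i hi => ?_
    have hi' := box_subset_succ k hi
    simp only [proj, latticeBranch, if_pos hi, if_pos hi', dif_pos hi, dif_pos hi',
      restrictBranches]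

theorem tendsto_finiteTransfer (hb : 0 < b) (hθ0 : 0 < θ) (hθ1 : θ < 1) (hβ : 0 < β) {p : I}
    {f Φ : (ℤ → I) → ℝ} (hf : f ∈ holderSpace θ β p) (hΦ : Φ ∈ holderSpace θ β p)
    (ζ : Fin b → I → I) (x : ℤ → I) :
    Tendsto (fun k => finiteTransfer ζ p f k Φ x) atTop (𝓝 (transfer ζ p f Φ x)) := by
  have hfb := abs_le_of_mem_holderSpace hf
  have hE : ∀ x, |Real.exp (f x)| ≤ Real.exp (supNorm f).toReal := fun x => by
    rw [abs_of_pos (Real.exp_pos _)]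
    exact Real.exp_le_exp.2 ((le_abs_self _).trans (hfb x))
  have hG := (((isHolder_of_mem_holderSpace hθ0 hθ1 hβ hf).exp hfb).mul hθ0
    (isHolder_of_mem_holderSpace hθ0 hθ1 hβ hΦ) hE (abs_le_of_mem_holderSpace hΦ))
  exact tendsto_nhds_limUnder
    (hG.exists_tendsto_branchAverage hb hθ0 hθ1 hβ (by positivity) ζ p x)

/-- The one-step Lasota-Yorke estimate, and the contraction of the sup norm, for the limit `T` of
the branch averages of `G Φ` normalized by the eigenfunction `h`. -/
theorem lasotaYorke_one_step (hb : 0 < b) (hτ : IsFullBranchExpanding τ ζ η)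
    (hθ0 : 0 < θ) (hθ1 : θ < 1) (hβ : 0 < β) (p : I) {G h Φ T : (ℤ → I) → ℝ}
    {KG MG Kh m l lam K M : ℝ} (hKG : 0 ≤ KG) (hK : 0 ≤ K)
    (hm : 0 < m) (hl : 0 < l) (hG : IsHolder θ β G KG) (hG0 : ∀ x, 0 ≤ G x) (hGM : ∀ x, G x ≤ MG)
    (hh : IsHolder θ β h Kh) (hhm : ∀ x, m ≤ h x) (hlam : l ≤ lam)
    (heig : ∀ x, Tendsto (fun k => branchAverage ζ p k G x) atTop (𝓝 (lam * h x)))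
    (hΦ : IsHolder θ β Φ K) (hM : ∀ x, |Φ x| ≤ M)
    (hT : ∀ x, Tendsto (fun k => branchAverage ζ p k (fun y => G y * Φ y) x) atTop (𝓝 (T x))) :
    (∀ x, |T x / (lam * h x)| ≤ M) ∧
      IsHolder θ β (fun x => T x / (lam * h x))
        (K * η ^ β + (KG * η ^ β / (l * m) + MG * Kh / (l * m * m)) * M) := by
  have hlam0 : 0 < lam := hl.trans_le hlam
  have hh0 : ∀ x, 0 < h x := fun x => hm.trans_le (hhm x)
  have hlh : ∀ x, 0 < lam * h x := fun x => mul_pos hlam0 (hh0 x)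
  refine ⟨fun x => ?_, fun x y => ?_⟩
  · rw [abs_div, abs_of_pos (hlh x), div_le_iff₀ (hlh x)]
    refine le_of_tendsto_of_tendsto' (hT x).abs ((heig x).const_mul M) fun k => ?_
    refine (abs_average_le k _).trans ?_
    rw [branchAverage, mul_left_comm, Finset.mul_sum _ _ M]
    gcongr with ω
    rw [abs_mul, abs_of_nonneg (hG0 _), mul_comm]
    exact mul_le_mul_of_nonneg_right (hM _) (hG0 _)
  · set C := KG * η ^ β / (l * m) + MG * Kh / (l * m * m) with hC
    have hM0 : 0 ≤ M := (abs_nonneg _).trans (hM x)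
    set δ := latticeDist θ x y ^ β
    have hδ0 : 0 ≤ δ := Real.rpow_nonneg (latticeDist_nonneg hθ0 x y) β
    have hη := Real.rpow_nonneg hτ.eta_pos.le β
    -- At finite `k` the mean weight need not be 1; the factor in front of `K η^β` is exactly 1 only
    -- in the limit.
    have hone := ((heig x).div_const (lam * h x)).mul_const (K * η ^ β * δ)
    rw [div_self (hlh x).ne'] at hone
    have hlim := (((hT x).div_const (lam * h x)).sub ((hT y).div_const (lam * h y))).abs
    have key := le_of_tendsto_of_tendsto' hlim (hone.add_const (C * δ * M)) fun k => ?_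
    · exact key.trans_eq (by ring)
    set u : (box k → Fin b) → ℤ → I := fun ω => proj p k (latticeBranch ζ k ω x)
    set v : (box k → Fin b) → ℤ → I := fun ω => proj p k (latticeBranch ζ k ω y)
    have hw : ∀ ω, |G (u ω) / (lam * h x) - G (v ω) / (lam * h y)| ≤ C * δ := fun ω => by
      -- The variation of the numerator `G` is separated from that of the denominator `h`; they give
      -- the two summands of `C`.
      have e : G (u ω) / (lam * h x) - G (v ω) / (lam * h y) =
          (G (u ω) - G (v ω)) / (lam * h x) +
            G (v ω) * (h y - h x) / (lam * h x * h y) := by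
        have := (hh0 x).ne'; have := (hh0 y).ne'; have := hlam0.ne'
        field_simp; ring
      have h1 : |G (u ω) - G (v ω)| ≤ KG * η ^ β * δ :=
        hG.abs_branch_sub_le hτ hθ0 hθ1 hβ hKG p k ω x y
      have h2 : |h y - h x| ≤ Kh * δ := by rw [abs_sub_comm]; exact hh x y
      have h3 : l * m ≤ lam * h x := mul_le_mul hlam (hhm x) hm.le hlam0.le
      have h4 : l * m * m ≤ lam * h x * h y := mul_le_mul h3 (hhm y) hm.le (hlh x).le
      have h5 : 0 < lam * h x * h y := mul_pos (hlh x) (hh0 y)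
      have h6 : 0 ≤ MG := (hG0 x).trans (hGM x)
      rw [e]
      refine (abs_add_le _ _).trans ?_
      rw [abs_div, abs_div, abs_of_pos (hlh x), abs_of_pos h5, abs_mul, abs_of_nonneg (hG0 _)]
      have h7 : |G (u ω) - G (v ω)| / (lam * h x) ≤ KG * η ^ β * δ / (l * m) := by gcongr
      have h8 : G (v ω) * |h y - h x| / (lam * h x * h y) ≤ MG * (Kh * δ) / (l * m * m) := by
        gcongr
        · exact mul_nonneg h6 ((abs_nonneg _).trans h2)
        · exact hGM _
      refine (add_le_add h7 h8).trans_eq ?_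
      rw [hC]; ring
    have e : branchAverage ζ p k (fun y => G y * Φ y) x / (lam * h x) -
        branchAverage ζ p k (fun y => G y * Φ y) y / (lam * h y) =
        (1 / (b : ℝ) ^ (2 * k + 1)) * ∑ ω, (G (u ω) / (lam * h x)) * (Φ (u ω) - Φ (v ω)) +
        (1 / (b : ℝ) ^ (2 * k + 1)) *
          ∑ ω, (G (u ω) / (lam * h x) - G (v ω) / (lam * h y)) * Φ (v ω) := by
      rw [← mul_add, ← Finset.sum_add_distrib, branchAverage, branchAverage, mul_div_assoc,
        mul_div_assoc, ← mul_sub, Finset.sum_div, Finset.sum_div, ← Finset.sum_sub_distrib]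
      congr 1
      refine Finset.sum_congr rfl fun ω _ => ?_
      ring
    rw [e]
    refine (abs_add_le _ _).trans (add_le_add ?_ ?_)
    · refine (abs_average_le k _).trans ?_
      rw [branchAverage, mul_div_assoc, mul_assoc, Finset.sum_div, Finset.sum_mul]
      gcongr with ω
      rw [abs_mul, abs_of_nonneg (div_nonneg (hG0 _) (hlh x).le)]
      exact mul_le_mul_of_nonneg_left (hΦ.abs_branch_sub_le hτ hθ0 hθ1 hβ hK p k ω x y)
        (div_nonneg (hG0 _) (hlh x).le)
    · refine abs_average_le_of_forall_le hb fun ω => ?_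
      rw [abs_mul]
      exact mul_le_mul (hw ω) (hM _) (abs_nonneg _) ((abs_nonneg _).trans (hw ω))

end Transfer

/-! ### Bounds on the eigenfunction and the eigenvalue, and iteration. -/

section Density

variable {I : Type*} [MetricSpace I] [BoundedSpace I] [MeasurableSpace (ℤ → I)]
  {b : ℕ} {θ β η : ℝ}

/-- On a bounded space the distortion bound makes all values of `h` comparable up to one factor `B`.
So `h`, being nonzero somewhere, is bounded away from zero and infinity. The measure serves only to
exclude `h = 0`, and the conclusion does not mention it. -/
theorem exists_isHolder_of_mem_densities (hθ0 : 0 < θ) (hθ1 : θ < 1) (hβ : 0 < β)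
    (hη0 : 0 < η) (hη1 : η < 1) {p : I} {f h : (ℤ → I) → ℝ} {ν : Measure (ℤ → I)}
    (hh : h ∈ densities θ β η p f ν) :
    ∃ K M m : ℝ, 0 ≤ K ∧ 0 < m ∧ IsHolder θ β h K ∧ ∀ x, m ≤ h x ∧ h x ≤ M := by
  obtain ⟨-, hpos, hint, hdist⟩ := hh
  set D := Metric.diam (Set.univ : Set I)
  have hD : 0 ≤ D := Metric.diam_nonneg
  set κ := (holderConst θ β p f).toReal * (η ^ β / (1 - η ^ β)) with hκ
  have hκ0 : 0 ≤ κ := mul_nonneg ENNReal.toReal_nonneg (div_nonneg (Real.rpow_nonneg hη0.le β)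
    (sub_nonneg.2 (Real.rpow_le_one hη0.le hη1.le hβ.le)))
  have hexp : ∀ x y : ℤ → I, κ * latticeDist θ x y ^ β ≤ κ * D ^ β := fun x y => by
    gcongr
    · exact latticeDist_nonneg hθ0 x y
    · exact latticeDist_le_diam hθ0 hθ1 x y
  set B := Real.exp (κ * D ^ β)
  have hB0 : 0 < B := Real.exp_pos _
  have hcmp : ∀ x y, h x ≤ B * h y := fun x y =>
    (hdist x y).trans (mul_le_mul_of_nonneg_right (Real.exp_le_exp.2 (hexp x y)) (hpos y))
  obtain ⟨z, hz⟩ : ∃ z, h z ≠ 0 := by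
    by_contra! hcon
    simp [hcon] at hint
  have hz0 : 0 < h z := lt_of_le_of_ne (hpos z) hz.symm
  -- For `0 ≤ t ≤ κ D^β` one has `e^t - 1 ≤ B t`, which turns the multiplicative bound into an
  -- additive one.
  have hone : ∀ x y, h x - h y ≤ B * h z * (B * κ) * latticeDist θ x y ^ β := fun x y => by
    have h1 := exp_sub_exp_le (b := 0) (hexp x y)
    have hδ : 0 ≤ κ * latticeDist θ x y ^ β :=
      mul_nonneg hκ0 (Real.rpow_nonneg (latticeDist_nonneg hθ0 x y) β)
    rw [Real.exp_zero, sub_zero, abs_of_nonneg hδ] at h1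
    have h2 := hdist x y
    rw [distortion, ← hκ] at h2
    calc h x - h y ≤ (Real.exp (κ * latticeDist θ x y ^ β) - 1) * h y := by linarith
      _ ≤ (B * (κ * latticeDist θ x y ^ β)) * (B * h z) :=
          mul_le_mul h1 (hcmp y z) (hpos y) (mul_nonneg hB0.le hδ)
      _ = _ := by ring
  refine ⟨B * h z * (B * κ), B * h z, h z / B, by positivity, by positivity, fun x y => ?_,
    fun x => ⟨?_, hcmp x z⟩⟩
  · have hsymm : latticeDist θ y x = latticeDist θ x y := by
      simp only [latticeDist, dist_comm]
    refine abs_le.2 ⟨?_, hone x y⟩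
    have := hone y x
    rw [hsymm] at this
    linarith
  · rw [div_le_iff₀' hB0]
    exact hcmp z x

theorem exp_neg_le_eigenvalue [BorelSpace (ℤ → I)] (hb : 0 < b) (hθ0 : 0 < θ) (hθ1 : θ < 1)
    (hβ : 0 < β) {ζ : Fin b → I → I} {p : I} {f : (ℤ → I) → ℝ} (hf : f ∈ holderSpace θ β p)
    {τ : I → I} (hτ : IsFullBranchExpanding τ ζ η)
    (ν : Measure (ℤ → I)) [IsProbabilityMeasure ν] :
    Real.exp (-(supNorm f).toReal) ≤ eigenvalue ζ p f ν := by
  set N := (supNorm f).toReal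
  have hfb := abs_le_of_mem_holderSpace hf
  have hEle : ∀ x, Real.exp (f x) ≤ Real.exp N := fun x =>
    Real.exp_le_exp.2 ((le_abs_self _).trans (hfb x))
  have h1 : (fun _ => 1 : (ℤ → I) → ℝ) ∈ holderSpace θ β p :=
    mem_holderSpace hθ0 hθ1 hβ p le_rfl (fun x y => by simp) (fun x => abs_one.le)
  have hlim := tendsto_finiteTransfer hb hθ0 hθ1 hβ hf h1 ζ
  have hav : ∀ k x, finiteTransfer ζ p f k (fun _ => 1) x =
      branchAverage ζ p k (fun x => Real.exp (f x)) x := fun k x => by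
    simp only [finiteTransfer, branchAverage, mul_one]
  have hE := (isHolder_of_mem_holderSpace hθ0 hθ1 hβ hf).exp hfb
  -- Continuity of `P 1` gives its measurability; with the bound `hub` it is integrable, as
  -- comparing integrals requires.
  have hHol : IsHolder θ β (transfer ζ p f fun _ => 1)
      (Real.exp N * (holderConst θ β p f).toReal * η ^ β) := fun x y => by
    refine le_of_tendsto' ((hlim x).sub (hlim y)).abs fun k => ?_
    rw [hav, hav, branchAverage, branchAverage, ← mul_sub, ← Finset.sum_sub_distrib]
    exact abs_average_le_of_forall_le hb fun ω =>
      hE.abs_branch_sub_le hτ hθ0 hθ1 hβ (by positivity) p k ω x y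
  have hub : ∀ x, |transfer ζ p f (fun _ => 1) x| ≤ Real.exp N := fun x => by
    refine le_of_tendsto' (hlim x).abs fun k => ?_
    rw [hav]
    exact abs_average_le_of_forall_le hb fun ω => by
      rw [abs_of_pos (Real.exp_pos _)]; exact hEle _
  have hlb : ∀ x, Real.exp (-N) ≤ transfer ζ p f (fun _ => 1) x := fun x => by
    refine ge_of_tendsto' (hlim x) fun k => ?_
    rw [hav]
    have := average_le_of_forall_le hb (k := k) (c := -Real.exp (-N))
      (u := fun ω => -Real.exp (f (proj p k (latticeBranch ζ k ω x)))) fun ω =>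
        neg_le_neg (Real.exp_le_exp.2 (neg_le.1 ((neg_le_abs _).trans (hfb _))))
    rw [Finset.sum_neg_distrib, mul_neg, neg_le_neg_iff] at this
    exact this
  have hint : Integrable (transfer ζ p f fun _ => 1) ν :=
    Integrable.of_bound (hHol.continuous hθ0 hθ1 hβ).aestronglyMeasurable (Real.exp N)
      (Eventually.of_forall hub)
  calc Real.exp (-N) = ∫ _, Real.exp (-N) ∂ν := by simp
    _ ≤ _ := integral_mono (integrable_const _) hint hlb

/-- The Lasota-Yorke inequality for the iterates of the normalized transfer operator, with a
constant that depends only on bounds for `h`. -/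
theorem lasotaYorke_iterate [BorelSpace (ℤ → I)] (hθ0 : 0 < θ) (hθ1 : θ < 1)
    (hβ : 0 < β) {τ : I → I} {ζ : Fin b → I → I} (hτ : IsFullBranchExpanding τ ζ η)
    {p : I} (hp : τ p = p) {f h : (ℤ → I) → ℝ} (hf : f ∈ holderSpace θ β p)
    {Kh Mh m : ℝ} (hKh : 0 ≤ Kh) (hm : 0 < m) (hh : IsHolder θ β h Kh)
    (hhb : ∀ x, m ≤ h x ∧ h x ≤ Mh) :
    ∃ C : ℝ, 0 < C ∧ ∀ ν : Measure (ℤ → I), IsProbabilityMeasure ν →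
      (∀ x, transfer ζ p f h x = eigenvalue ζ p f ν * h x) →
      ∀ Φ K M, 0 ≤ K → 0 ≤ M → IsHolder θ β Φ K → (∀ x, |Φ x| ≤ M) → ∀ n : ℕ,
        IsHolder θ β ((normalizedTransfer ζ p f ν h)^[n] Φ) (K * η ^ (β * n) + C * M) ∧
        ∀ x, |(normalizedTransfer ζ p f ν h)^[n] Φ x| ≤ M := by
  have hb := hτ.card_pos hp
  set N := (supNorm f).toReal
  have hfb := abs_le_of_mem_holderSpace hf
  have hE0 : ∀ x, |Real.exp (f x)| ≤ Real.exp N := fun x => by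
    rw [abs_of_pos (Real.exp_pos _)]
    exact Real.exp_le_exp.2 ((le_abs_self _).trans (hfb x))
  have hh0 : ∀ x, 0 ≤ h x := fun x => hm.le.trans (hhb x).1
  have hhabs : ∀ x, |h x| ≤ Mh := fun x => by rw [abs_of_nonneg (hh0 x)]; exact (hhb x).2
  have hMh : 0 ≤ Mh := (hh0 fun _ => p).trans (hhb _).2
  have hG := ((isHolder_of_mem_holderSpace hθ0 hθ1 hβ hf).exp hfb).mul hθ0 hh hE0 hhabs
  set KG := Real.exp N * Kh + Real.exp N * (holderConst θ β p f).toReal * Mh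
  have hKG : 0 ≤ KG := by positivity
  have hhC : h ∈ holderSpace θ β p := mem_holderSpace hθ0 hθ1 hβ p hKh hh hhabs
  have hηβ0 : 0 < η ^ β := Real.rpow_pos_of_pos hτ.eta_pos β
  have hηβ1 : 0 < 1 - η ^ β := sub_pos.2 (Real.rpow_lt_one hτ.eta_pos.le hτ.eta_lt_one hβ)
  set l := Real.exp (-N)
  have hl0 : 0 < l := Real.exp_pos _
  set c := KG * η ^ β / (l * m) + Real.exp N * Mh * Kh / (l * m * m)
  have hc : 0 ≤ c := by positivity
  -- The one-step error `c` is absorbed as soon as `C η^β + c ≤ C`; the extra 1 keeps `C` positive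
  -- when `c = 0`.
  refine ⟨(c + 1) / (1 - η ^ β), by positivity, fun ν hν heig Φ K M hK hM hΦ hΦM n => ?_⟩
  set C := (c + 1) / (1 - η ^ β)
  have hC0 : 0 ≤ C := by positivity
  have hCeq : C * (1 - η ^ β) = c + 1 := div_mul_cancel₀ _ hηβ1.ne'
  have hlam : l ≤ eigenvalue ζ p f ν := exp_neg_le_eigenvalue hb hθ0 hθ1 hβ hf hτ ν
  have hη0 := hτ.eta_pos
  induction n with
  | zero =>
    refine ⟨fun x y => (hΦ x y).trans ?_, hΦM⟩
    have := Real.rpow_nonneg (latticeDist_nonneg hθ0 x y) β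
    gcongr
    simp only [Nat.cast_zero, mul_zero, Real.rpow_zero, mul_one]
    linarith [mul_nonneg hC0 hM]
  | succ n ih =>
    obtain ⟨ihH, ihM⟩ := ih
    have hKn : 0 ≤ K * η ^ (β * n) + C * M := by positivity
    set Ψ := (normalizedTransfer ζ p f ν h)^[n] Φ
    have hhΨ : (fun y => h y * Ψ y) ∈ holderSpace θ β p := by
      refine mem_holderSpace hθ0 hθ1 hβ p (by positivity) (hh.mul hθ0 ihH hhabs ihM)
        (M := Mh * M) fun x => ?_
      rw [abs_mul]
      exact mul_le_mul (hhabs x) (ihM x) (abs_nonneg _) hMh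
    have step := lasotaYorke_one_step hb hτ hθ0 hθ1 hβ p hKG hKn hm hl0 hG
      (fun x => mul_nonneg (Real.exp_pos _).le (hh0 x))
      (fun x => mul_le_mul ((le_abs_self _).trans (hE0 x)) (hhb x).2 (hh0 x) (Real.exp_pos _).le)
      hh (fun x => (hhb x).1) hlam
      (fun x => by rw [← heig x]; exact tendsto_finiteTransfer hb hθ0 hθ1 hβ hf hhC ζ x)
      ihH ihM (T := transfer ζ p f fun y => h y * Ψ y) (fun x => by
        simpa only [finiteTransfer, branchAverage, mul_assoc] using
          tendsto_finiteTransfer hb hθ0 hθ1 hβ hf hhΨ ζ x)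
    rw [Function.iterate_succ_apply']
    refine ⟨fun x y => (step.2 x y).trans ?_, step.1⟩
    have hδ := Real.rpow_nonneg (latticeDist_nonneg hθ0 x y) β
    have hpow : η ^ (β * (n + 1 : ℕ)) = η ^ (β * n) * η ^ β := by
      rw [← Real.rpow_add hη0]; push_cast; ring_nf
    rw [hpow]
    refine mul_le_mul_of_nonneg_right ?_ hδ
    have : C * M = C * M * η ^ β + (c + 1) * M := by rw [← hCeq]; ring
    change (K * η ^ (β * n) + C * M) * η ^ β + c * M ≤ _
    linarith

end Density

end LatticeMap

/-! ### The main theorem. -/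

theorem mainTheorem5 {I : Type*} [MetricSpace I] [BoundedSpace I]
    [MeasurableSpace (ℤ → I)] [BorelSpace (ℤ → I)]
    (θ β η : ℝ) (hθ0 : 0 < θ) (hθ1 : θ < 1) (hβ : 0 < β)
    (τ : I → I) {b : ℕ} (ζ : Fin b → I → I) (hτ : LatticeMap.IsFullBranchExpanding τ ζ η)
    (p : I) (hp : τ p = p)
    (f : (ℤ → I) → ℝ) (hf : f ∈ LatticeMap.holderSpace θ β p) :
    (∀ Φ ∈ LatticeMap.holderSpace θ β p, ∀ x : ℤ → I,
      Tendsto (fun k => LatticeMap.finiteTransfer ζ p f k Φ x) atTop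
        (𝓝 (LatticeMap.transfer ζ p f Φ x))) ∧
    ∀ h : (ℤ → I) → ℝ, ∃ C₅ : ℝ, 0 < C₅ ∧
      ∀ ν : Measure (ℤ → I), LatticeMap.IsEigenmeasure θ β ζ p f ν →
        h ∈ LatticeMap.densities θ β η p f ν →
        (∀ x, LatticeMap.transfer ζ p f h x = LatticeMap.eigenvalue ζ p f ν * h x) →
        ∀ Φ ∈ LatticeMap.holderSpace θ β p, ∀ n : ℕ,
          (LatticeMap.normalizedTransfer ζ p f ν h)^[n] Φ ∈ LatticeMap.holderSpace θ β p ∧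
          LatticeMap.holderConst θ β p ((LatticeMap.normalizedTransfer ζ p f ν h)^[n] Φ) ≤
            LatticeMap.holderConst θ β p Φ * ENNReal.ofReal (η ^ (β * n)) +
              ENNReal.ofReal C₅ * LatticeMap.supNorm Φ := by
  refine ⟨fun Φ hΦ x => LatticeMap.tendsto_finiteTransfer (hτ.card_pos hp) hθ0 hθ1 hβ hf hΦ ζ x,
    fun h => ?_⟩
  -- The constant must be fixed before `ν`, so the bounds on `h` are requested without reference to
  -- `ν`. If there are none, `h` is a density for no `ν`, and any constant will do.
  by_cases hex : ∃ K M m : ℝ, 0 ≤ K ∧ 0 < m ∧ LatticeMap.IsHolder θ β h K ∧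
      ∀ x, m ≤ h x ∧ h x ≤ M
  · obtain ⟨Kh, Mh, m, hKh, hm, hh, hhb⟩ := hex
    obtain ⟨C, hC, key⟩ := LatticeMap.lasotaYorke_iterate hθ0 hθ1 hβ hτ hp hf hKh hm hh hhb
    refine ⟨C, hC, fun ν hν _ heig Φ hΦ n => ?_⟩
    obtain ⟨hH, hM⟩ := key ν hν.prob heig Φ _ _ ENNReal.toReal_nonneg ENNReal.toReal_nonneg
      (LatticeMap.isHolder_of_mem_holderSpace hθ0 hθ1 hβ hΦ)
      (LatticeMap.abs_le_of_mem_holderSpace hΦ) n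
    have hη : 0 ≤ η ^ (β * n) := Real.rpow_nonneg hτ.eta_pos.le _
    have hfin := ENNReal.add_lt_top.1 hΦ.2
    refine ⟨LatticeMap.mem_holderSpace hθ0 hθ1 hβ p (by positivity) hH hM, ?_⟩
    refine (LatticeMap.holderConst_le hθ0 hθ1 hβ p (by positivity) hH).trans_eq ?_
    rw [ENNReal.ofReal_add (by positivity) (by positivity),
      ENNReal.ofReal_mul ENNReal.toReal_nonneg, ENNReal.ofReal_mul hC.le,
      ENNReal.ofReal_toReal hfin.1.ne, ENNReal.ofReal_toReal hfin.2.ne]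
  · exact ⟨1, one_pos, fun ν _ hh => (hex (LatticeMap.exists_isHolder_of_mem_densities hθ0 hθ1 hβ
      hτ.eta_pos hτ.eta_lt_one hh)).elim⟩
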